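/- Let $n\in\mathbb N$, equip $L^2(\mathbb R^n)=L^2(\mathbb R^n;\mathbb C)$ with the symplectic form $\beta(f,h)=\tfrac12\operatorname{Im}\langle f,h\rangle$ (inner product conjugate-linear in the first argument), and let $\mathcal W$ be the Weyl algebra over $(L^2(\mathbb R^n),\beta)$, i.e. the (unique) nonzero unital $C^*$-algebra generated by elements $W(z)$, $z\in L^2(\mathbb R^n)$, with $W(0)=1$, $W(-z)=W(z)^*$ and $W(y)W(z)=e^{i\beta(y,z)}W(y+z)$. Let $\omega$ be a state on $\mathcal W$ whose induced function $g\colon L^2(\mathbb R^n)\to\mathbb C$, $g(z)=\omega(W(z))$, is continuous. Let $\mathcal S_{\mathbb R}$ be the space of real-valued Schwartz functions on $\mathbb R^n$, $\mathcal S_{\mathbb R}'$ its real topological dual with the weak* topology, and $\mathcal D_{\mathbb R}$ the space of real-valued test functions on $\mathbb R^n$ with its usual inductive limit topology. Say that a Borel measure $\nu$ on $\mathcal S_{\mathbb R}'$ has polynomial growth if for all $k\in\mathbb N$ and $\psi_1,\dots,\psi_k\in\mathcal S_{\mathbb R}$ the function $u\mapsto\langle u,\psi_1\rangle\cdots\langle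 u,\psi_k\rangle$ is $\nu$-integrable. 1. If $\nu_1$ is the regular Borel probability measure on $\mathcal S_{\mathbb R}'$ with $g(\varphi)=\int e^{i\langle u,\varphi\rangle}\,d\nu_1(u)$ for all $\varphi\in\mathcal S_{\mathbb R}$, and $\nu_1$ has polynomial growth, then the function $\mathcal D_{\mathbb R}\to\mathbb C$, $\varphi\mapsto g(\varphi)$, defines a Colombeau generalized function on $\mathbb R^n$. 2. If $\nu_2$ is the regular Borel probability measure on $\mathcal S_{\mathbb R}'$ with $g(i\varphi)=\int e^{i\langle v,\varphi\rangle}\,d\nu_2(v)$ for all $\varphi\in\mathcal S_{\mathbb R}$, and $\nu_2$ has polynomial growth, then the function $\mathcal D_{\mathbb R}\to\mathbb C$, $\varphi\mapsto g(i\varphi)$, defines a Colombeau generalized function on $\mathbb R^n$. Here $R\colon\mathcal D_{\mathbb R}\to\mathbb C$ is *smooth* if it maps smooth curves $\mathbb R\to\mathcal D_{\mathbb R}$ to smooth curves in $\mathbb C$ (smoothness in the convenient setting); then for every $\varphi\in\mathcal D_{\mathbb R}$ and $\varepsilon>0$ the function $x\mapsto R(\varphi_{\varepsilon,x})$, where $\varphi_{\varepsilon,x}(y)=\varepsilon^{-n}\varphi((y-x)/\varepsilon)$,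 is $C^\infty$ on $\mathbb R^n$. For $q\in\mathbb N$ let $\mathcal A_q$ be the set of $\varphi\in\mathcal D_{\mathbb R}$ with $\int\varphi=1$ and $\int x^\alpha\varphi(x)\,dx=0$ for $1\le|\alpha|\le q$. A smooth $R$ is *moderate* if for all compact $K\subset\mathbb R^n$ and all $k\in\mathbb N$ there is $N\in\mathbb N$ such that for all $\varphi\in\mathcal A_N$ the derivatives of order $k$ of $x\mapsto R(\varphi_{\varepsilon,x})$ are $O(\varepsilon^{-N})$ as $\varepsilon\to0^+$, uniformly on $K$. A moderate $R$ is *negligible* if for all compact $K$ and all $k,m\in\mathbb N$ there is $q\in\mathbb N$ such that for all $\varphi\in\mathcal A_q$ these derivatives are $O(\varepsilon^m)$ uniformly on $K$. The algebra of Colombeau generalized functions on $\mathbb R^n$ is the quotient of the algebra of moderate functions by the ideal of negligible ones; $R$ *defines* a Colombeau generalized function if it is smooth and moderate, and the generalized function is then its class in this quotient. -/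

import Mathlib

open MeasureTheory Filter Topology
open scoped SchwartzMap Distributions ENNReal

/-! ## The Weyl algebra and its states -/

/-- `A`, with the family `W`, is the Weyl algebra over the real vector space `S` with the symplectic
form `β`: a nonzero unital C*-algebra which is generated as a C*-algebra by elements `W z`, `z ∈ S`,
that satisfy the Weyl relations, the unit being `W 0`. -/
structure IsWeylAlgebra {S : Type*} [AddCommGroup S] [Module ℝ S] (β : LinearMap.BilinForm ℝ S)
    {A : Type*} [CStarAlgebra A] (W : S → A) : Prop where
  nontrivial : Nontrivial A
  map_zero : W 0 = 1
  map_neg : ∀ z, W (-z) = star (W z)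
  mul_eq : ∀ y z, W y * W z = Complex.exp (Complex.I * β y z) • W (y + z)
  generates : (StarAlgebra.adjoin ℂ (Set.range W)).topologicalClosure = ⊤

open scoped ComplexOrder in
/-- A state on a unital C*-algebra: a normalized positive linear functional. -/
structure IsState {A : Type*} [CStarAlgebra A] (ω : A →ₗ[ℂ] ℂ) : Prop where
  map_one : ω 1 = 1
  nonneg : ∀ a, 0 ≤ ω (star a * a)

namespace WeylModel

/-! The Weyl algebra exists: it is generated by twisted translations on `ℓ²(S)`. -/

variable {S : Type*} [AddCommGroup S] [Module ℝ S] (β : LinearMap.BilinForm ℝ S)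

/-- The twisted translation `(W z ξ) x = exp (i β z x) ξ (x - z)` of functions on `S`. -/
noncomputable def twist (z : S) (ξ : S → ℂ) (x : S) : ℂ :=
  Complex.exp (Complex.I * β z x) * ξ (x - z)

theorem norm_twist (z : S) (ξ : S → ℂ) (x : S) : ‖twist β z ξ x‖ = ‖ξ (x - z)‖ := by
  rw [twist, norm_mul, mul_comm Complex.I, Complex.norm_exp_ofReal_mul_I, one_mul]

theorem memℓp_twist (z : S) {ξ : S → ℂ} (h : Memℓp ξ 2) : Memℓp (twist β z ξ) 2 := by
  have h2 : (0 : ℝ) < (2 : ℝ≥0∞).toReal := by norm_num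
  rw [memℓp_gen_iff h2] at h ⊢
  simp only [norm_twist]
  exact (Equiv.subRight z).summable_iff.mpr h

/-- The twisted translation as an isometry of `ℓ²(S)`. -/
noncomputable def op (z : S) : lp (fun _ : S => ℂ) 2 →ₗᵢ[ℂ] lp (fun _ : S => ℂ) 2 where
  toFun ξ := ⟨twist β z ξ, memℓp_twist β z ξ.2⟩
  map_add' ξ η := by ext x; exact mul_add _ _ _
  map_smul' c ξ := by ext x; simp [twist, mul_left_comm]
  norm_map' ξ := by
    have h2 : (0 : ℝ) < (2 : ℝ≥0∞).toReal := by norm_num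
    rw [lp.norm_eq_tsum_rpow h2, lp.norm_eq_tsum_rpow h2]
    congr 1
    change ∑' x, ‖twist β z ξ x‖ ^ _ = _
    simp only [norm_twist]
    exact (Equiv.subRight z).tsum_eq (fun x => ‖ξ x‖ ^ (2 : ℝ≥0∞).toReal)

theorem op_apply (z : S) (ξ : lp (fun _ : S => ℂ) 2) (x : S) :
    op β z ξ x = Complex.exp (Complex.I * β z x) * ξ (x - z) := rfl

/-- The twisted translation as a bounded operator on `ℓ²(S)`. -/
noncomputable def clm (z : S) : lp (fun _ : S => ℂ) 2 →L[ℂ] lp (fun _ : S => ℂ) 2 :=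
  (op β z).toContinuousLinearMap

theorem clm_zero : clm β (0 : S) = 1 := by
  ext ξ x
  simp [clm, op_apply]

variable {β}

theorem clm_mul (hβ : β.IsAlt) (y z : S) :
    clm β y * clm β z = Complex.exp (Complex.I * β y z) • clm β (y + z) := by
  ext ξ x
  have h : β z y = - β y z := by rw [← LinearMap.IsAlt.neg hβ]
  change Complex.exp (Complex.I * β y x) * (Complex.exp (Complex.I * β z (x - y)) *
      (ξ : S → ℂ) (x - y - z)) = Complex.exp (Complex.I * β y z) *
        (Complex.exp (Complex.I * β (y + z) x) * (ξ : S → ℂ) (x - (y + z)))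
  rw [← mul_assoc, ← mul_assoc, ← Complex.exp_add, ← Complex.exp_add, sub_sub]
  congr 2
  simp only [map_add, map_sub, LinearMap.add_apply, h]
  push_cast
  ring

theorem clm_neg (hβ : β.IsAlt) (z : S) : clm β (-z) = star (clm β z) := by
  have h1 : star (clm β z) * clm β z = 1 := by
    rw [ContinuousLinearMap.star_eq_adjoint]
    exact (ContinuousLinearMap.norm_map_iff_adjoint_comp_self _).1 (op β z).norm_map
  have h2 : clm β z * clm β (-z) = 1 := by
    rw [clm_mul hβ, add_neg_cancel, clm_zero, map_neg, hβ.self_eq_zero]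
    simp
  calc clm β (-z) = star (clm β z) * clm β z * clm β (-z) := by rw [h1, one_mul]
    _ = star (clm β z) := by rw [mul_assoc, h2, mul_one]

end WeylModel

theorem exists_isWeylAlgebra {S : Type*} [AddCommGroup S] [Module ℝ S]
    (β : LinearMap.BilinForm ℝ S) (hβ : β.IsAlt) :
    ∃ (A : StarSubalgebra ℂ (lp (fun _ : S => ℂ) 2 →L[ℂ] lp (fun _ : S => ℂ) 2))
      (_ : IsClosed (A : Set (lp (fun _ : S => ℂ) 2 →L[ℂ] lp (fun _ : S => ℂ) 2)))
      (W : S → A), IsWeylAlgebra β W := by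
  classical
  let B := StarAlgebra.adjoin ℂ (Set.range (WeylModel.clm β))
  have hsub : Set.range (WeylModel.clm β) ⊆ B.topologicalClosure :=
    (StarAlgebra.subset_adjoin ℂ _).trans B.le_topologicalClosure
  have hcl := B.isClosed_topologicalClosure
  refine ⟨B.topologicalClosure, hcl, fun z => ⟨WeylModel.clm β z, hsub ⟨z, rfl⟩⟩, ?_, ?_, ?_, ?_, ?_⟩
  · have : Nontrivial (lp (fun _ : S => ℂ) 2) := by
      refine ⟨lp.single 2 (0 : S) (1 : ℂ), 0, fun h => ?_⟩
      have := congrArg (fun f : lp (fun _ : S => ℂ) 2 => f 0) h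
      simp at this
    infer_instance
  · exact Subtype.ext (WeylModel.clm_zero β)
  · exact fun z => Subtype.ext (WeylModel.clm_neg hβ z)
  · exact fun y z => Subtype.ext (WeylModel.clm_mul hβ y z)
  · rw [eq_top_iff]
    intro a _
    have key : (StarAlgebra.adjoin ℂ (Set.range fun z =>
        (⟨WeylModel.clm β z, hsub ⟨z, rfl⟩⟩ : B.topologicalClosure))).map
          B.topologicalClosure.subtype = B := by
      rw [StarAlgHom.map_adjoin, ← Set.range_comp]
      rfl
    rw [← SetLike.mem_coe, StarSubalgebra.topologicalClosure_coe,
      Topology.IsEmbedding.subtypeVal.closure_eq_preimage_closure_image]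
    have hle : B ≤ (StarAlgebra.adjoin ℂ (Set.range fun z =>
        (⟨WeylModel.clm β z, hsub ⟨z, rfl⟩⟩ : B.topologicalClosure))).map
          B.topologicalClosure.subtype := key.ge
    exact closure_mono hle a.2

/-! ## The one-particle space, real Schwartz functions and real temperate distributions -/

/-- `ℝⁿ` with its Euclidean structure. -/
abbrev RSpace (n : ℕ) : Type := EuclideanSpace ℝ (Fin n)

/-- The complex Hilbert space `L²(ℝⁿ)`. -/
abbrev L2Space (n : ℕ) : Type := Lp ℂ 2 (volume : Measure (RSpace n))

/-- The real symplectic form `β(f, g) = Im ⟨f, g⟩ / 2` on `L²(ℝⁿ)`. -/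
noncomputable def symplecticForm (n : ℕ) : LinearMap.BilinForm ℝ (L2Space n) :=
  LinearMap.mk₂ ℝ (fun f g => (inner ℂ f g).im / 2)
    (fun f f' g => by simp only [inner_add_left, Complex.add_im]; ring)
    (fun c f g => by
      have h : c • f = (c : ℂ) • f := (algebraMap_smul ℂ c f).symm
      rw [h, inner_smul_left, Complex.conj_ofReal, Complex.im_ofReal_mul, smul_eq_mul]
      ring)
    (fun f g g' => by simp only [inner_add_right, Complex.add_im]; ring)
    (fun c f g => by
      have h : c • g = (c : ℂ) • g := (algebraMap_smul ℂ c g).symm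
      rw [h, inner_smul_right, Complex.im_ofReal_mul, smul_eq_mul]
      ring)

theorem symplecticForm_isAlt (n : ℕ) : (symplecticForm n).IsAlt := fun f => by
  change (inner ℂ f f).im / 2 = 0
  have h : (inner ℂ f f).im = 0 := inner_self_im (𝕜 := ℂ) f
  rw [h, zero_div]

/-- The class in `L²(ℝⁿ)` of a real-valued Schwartz function. -/
noncomputable def schwartzToL2 {n : ℕ} (φ : 𝓢(RSpace n, ℝ)) : L2Space n :=
  (SchwartzMap.postcompCLM Complex.ofRealCLM φ).toLp 2

/-- The space of real temperate distributions, the dual of the space of real-valued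
Schwartz functions, with the weak* topology. -/
abbrev RealTempered (n : ℕ) : Type := 𝓢(RSpace n, ℝ) →Lₚₜ[ℝ] ℝ

/-- Real temperate distributions carry the Borel σ-algebra. -/
noncomputable instance (n : ℕ) : MeasurableSpace (RealTempered n) := borel _

instance (n : ℕ) : BorelSpace (RealTempered n) := ⟨rfl⟩

/-- `F` is the generating functional `F φ = ∫ exp (i ⟨u, φ⟩) dν(u)` of the measure `ν`. -/
def IsGeneratingFunctional {n : ℕ} (ν : Measure (RealTempered n)) (F : 𝓢(RSpace n, ℝ) → ℂ) :
    Prop :=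
  ∀ φ, F φ = ∫ u : RealTempered n, Complex.exp (Complex.I * (u φ : ℝ)) ∂ν

/-- The polynomial growth condition: all functions `u ↦ ⟨u, ψ₁⟩ ⋯ ⟨u, ψₖ⟩` are integrable. -/
def HasPolynomialGrowth {n : ℕ} (ν : Measure (RealTempered n)) : Prop :=
  ∀ (k : ℕ) (ψ : Fin k → 𝓢(RSpace n, ℝ)),
    Integrable (fun u : RealTempered n => ∏ j, u (ψ j)) ν

/-! ## Smoothness in the sense of convenient calculus -/

section Convenient

open scoped ContDiff

variable {E : Type*} [AddCommGroup E] [Module ℝ E] [TopologicalSpace E]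

/-- The curve `c'` is the derivative of the curve `c` in the topological vector space `E`. -/
def IsDerivCurve (c c' : ℝ → E) : Prop :=
  ∀ t, Tendsto (fun h : ℝ => h⁻¹ • (c (t + h) - c t)) (𝓝[≠] 0) (𝓝 (c' t))

/-- A smooth curve in `E`: all iterated derivatives exist. -/
def IsSmoothCurve (c : ℝ → E) : Prop :=
  ∃ d : ℕ → ℝ → E, d 0 = c ∧ ∀ k, IsDerivCurve (d k) (d (k + 1))

/-- A function is smooth in the convenient sense if it maps smooth curves to smooth curves. -/
def IsConvenientSmooth (R : E → ℂ) : Prop :=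
  ∀ c : ℝ → E, IsSmoothCurve c → ContDiff ℝ ∞ (fun t => R (c t))

end Convenient

/-! ## The Colombeau algebra on `ℝⁿ`, based on smooth functions on the space of test functions -/

namespace Colombeau

open scoped ContDiff

/-- The space of real-valued test functions on `ℝⁿ`, with its usual inductive limit topology. -/
abbrev RealTest (n : ℕ) : Type := 𝓓((⊤ : TopologicalSpace.Opens (RSpace n)), ℝ)

variable {n : ℕ}

/-- A test function as a Schwartz function. -/
noncomputable def RealTest.toSchwartz (φ : RealTest n) : 𝓢(RSpace n, ℝ) :=
  φ.hasCompactSupport.toSchwartzMap φ.contDiff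

/-- The set `A_q` of test functions with integral one and vanishing moments
of the orders `1, …, q`. -/
def momentClass (n q : ℕ) : Set (RealTest n) :=
  {φ | ∫ x, φ x = 1 ∧
    ∀ α : Fin n → ℕ, 1 ≤ ∑ i, α i → ∑ i, α i ≤ q → ∫ x, (∏ i, x i ^ α i) * φ x = 0}

theorem momentClass_anti {p q : ℕ} (h : p ≤ q) : momentClass n q ⊆ momentClass n p :=
  fun _ hφ => ⟨hφ.1, fun α h1 h2 => hφ.2 α h1 (h2.trans h)⟩

/-- The scaled and shifted test function `φ_{ε,x}(y) = ε⁻ⁿ φ ((y - x) / ε)`. It is used only for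
`ε > 0`, and set to zero otherwise. -/
noncomputable def deltaNet (φ : RealTest n) (ε : ℝ) (x : RSpace n) : RealTest n :=
  if hε : 0 < ε then
    { toFun := fun y => (ε ^ n)⁻¹ * φ (ε⁻¹ • (y - x))
      contDiff' := by
        have := φ.contDiff
        fun_prop
      hasCompactSupport' := by
        have h : HasCompactSupport (fun y => φ (ε⁻¹ • (y - x))) :=
          φ.hasCompactSupport.comp_homeomorph
            ((Homeomorph.subRight x).trans (Homeomorph.smulOfNeZero ε⁻¹ (inv_ne_zero hε.ne')))
        exact h.mul_left
      tsupport_subset' := fun _ _ => trivial }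
  else 0

/-- The estimate `|∂ᵅₓ R(φ_{ε,x})| = O(εᵐ)` as `ε → 0`, uniformly for `x ∈ K`,
for all derivatives of order `k`. -/
def DerivBound (R : RealTest n → ℂ) (K : Set (RSpace n)) (φ : RealTest n) (k : ℕ) (m : ℤ) : Prop :=
  ∃ C : ℝ, ∀ᶠ ε in 𝓝[>] (0 : ℝ), ∀ x ∈ K,
    ‖iteratedFDeriv ℝ k (fun y => R (deltaNet φ ε y)) x‖ ≤ C * ε ^ m

/-- Smoothness in the convenient sense on real test functions. By Boman's theorem the first
condition implies the second, which is recorded so that the derivatives in `DerivBound` make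
sense. -/
structure IsSmooth (R : RealTest n → ℂ) : Prop where
  convenient : IsConvenientSmooth R
  contDiff_net : ∀ (φ : RealTest n) (ε : ℝ), 0 < ε → ContDiff ℝ ∞ (fun x => R (deltaNet φ ε x))

/-- Moderateness: `R` is smooth, and for all compact `K` and all orders `k` there is `N` such that
for all `φ ∈ A_N` the derivatives of order `k` of `x ↦ R(φ_{ε,x})` are `O(ε⁻ᴺ)` on `K`. -/
structure IsModerate (R : RealTest n → ℂ) : Prop where
  smooth : IsSmooth R
  bound : ∀ K : Set (RSpace n), IsCompact K → ∀ k : ℕ, ∃ N : ℕ, ∀ φ ∈ momentClass n N,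
    DerivBound R K φ k (-(N : ℤ))

/-- Negligibility: for all compact `K` and all orders `k` and `m` there is `q` such that
for all `φ ∈ A_q` the derivatives of order `k` of `x ↦ R(φ_{ε,x})` are `O(εᵐ)` on `K`. -/
def IsNegligible (R : RealTest n → ℂ) : Prop :=
  ∀ K : Set (RSpace n), IsCompact K → ∀ k m : ℕ, ∃ q : ℕ, ∀ φ ∈ momentClass n q,
    DerivBound R K φ k m

section Bounds

variable {R T : RealTest n → ℂ} {K : Set (RSpace n)} {φ : RealTest n} {k : ℕ} {m m' : ℤ}

theorem DerivBound.mono (h : DerivBound R K φ k m) (hm : m' ≤ m) : DerivBound R K φ k m' := by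
  obtain ⟨C, hC⟩ := h
  refine ⟨|C|, ?_⟩
  filter_upwards [hC, Ioo_mem_nhdsGT (zero_lt_one : (0 : ℝ) < 1)] with ε h1 h2 x hx
  calc _ ≤ C * ε ^ m := h1 x hx
    _ ≤ |C| * ε ^ m := mul_le_mul_of_nonneg_right (le_abs_self C) (zpow_pos h2.1 _).le
    _ ≤ |C| * ε ^ m' := mul_le_mul_of_nonneg_left
        (zpow_le_zpow_right_of_le_one₀ h2.1 h2.2.le hm) (abs_nonneg C)

theorem DerivBound.add (hR : IsSmooth R) (hT : IsSmooth T) (h1 : DerivBound R K φ k m)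
    (h2 : DerivBound T K φ k m) : DerivBound (R + T) K φ k m := by
  obtain ⟨C, hC⟩ := h1
  obtain ⟨D, hD⟩ := h2
  refine ⟨C + D, ?_⟩
  filter_upwards [hC, hD, self_mem_nhdsWithin] with ε h1 h2 hε x hx
  have e : iteratedFDeriv ℝ k (fun y => (R + T) (deltaNet φ ε y)) x =
      iteratedFDeriv ℝ k (fun y => R (deltaNet φ ε y)) x +
        iteratedFDeriv ℝ k (fun y => T (deltaNet φ ε y)) x :=
    iteratedFDeriv_add_apply
      ((hR.contDiff_net φ ε hε).of_le (mod_cast le_top)).contDiffAt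
      ((hT.contDiff_net φ ε hε).of_le (mod_cast le_top)).contDiffAt
  rw [e, add_mul]
  exact (norm_add_le _ _).trans (add_le_add (h1 x hx) (h2 x hx))

theorem DerivBound.mul (hR : IsSmooth R) (hT : IsSmooth T)
    (h1 : ∀ i ≤ k, DerivBound R K φ i m) (h2 : ∀ i ≤ k, DerivBound T K φ i m') :
    DerivBound (R * T) K φ k (m + m') := by
  choose! C hC using h1
  choose! D hD using h2
  refine ⟨∑ i ∈ Finset.range (k + 1), (k.choose i : ℝ) * |C i| * |D (k - i)|, ?_⟩
  have hC' : ∀ᶠ ε in 𝓝[>] (0 : ℝ), ∀ i ∈ Finset.range (k + 1), ∀ x ∈ K,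
      ‖iteratedFDeriv ℝ i (fun y => R (deltaNet φ ε y)) x‖ ≤ C i * ε ^ m :=
    (eventually_all_finset _).2 fun i hi => hC i (Nat.lt_succ_iff.1 (Finset.mem_range.1 hi))
  have hD' : ∀ᶠ ε in 𝓝[>] (0 : ℝ), ∀ i ∈ Finset.range (k + 1), ∀ x ∈ K,
      ‖iteratedFDeriv ℝ i (fun y => T (deltaNet φ ε y)) x‖ ≤ D i * ε ^ m' :=
    (eventually_all_finset _).2 fun i hi => hD i (Nat.lt_succ_iff.1 (Finset.mem_range.1 hi))
  filter_upwards [hC', hD', self_mem_nhdsWithin] with ε h1 h2 hε x hx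
  have hε' : 0 < ε := hε
  refine (norm_iteratedFDeriv_mul_le (N := ∞) (hR.contDiff_net φ ε hε) (hT.contDiff_net φ ε hε) x
    (mod_cast le_top)).trans ?_
  rw [Finset.sum_mul]
  refine Finset.sum_le_sum fun i hi => ?_
  have hi' : k - i ∈ Finset.range (k + 1) := Finset.mem_range.2 (by omega)
  have a1 : ‖iteratedFDeriv ℝ i (fun y => R (deltaNet φ ε y)) x‖ ≤ |C i| * ε ^ m :=
    (h1 i hi x hx).trans (mul_le_mul_of_nonneg_right (le_abs_self _) (zpow_pos hε' _).le)
  have a2 : ‖iteratedFDeriv ℝ (k - i) (fun y => T (deltaNet φ ε y)) x‖ ≤ |D (k - i)| * ε ^ m' :=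
    (h2 _ hi' x hx).trans (mul_le_mul_of_nonneg_right (le_abs_self _) (zpow_pos hε' _).le)
  rw [zpow_add₀ hε'.ne']
  calc _ ≤ (k.choose i : ℝ) * (|C i| * ε ^ m) * (|D (k - i)| * ε ^ m') := by gcongr
    _ = _ := by ring

theorem IsSmooth.const (c : ℂ) : IsSmooth (fun _ : RealTest n => c) :=
  ⟨fun _ _ => contDiff_const, fun _ _ _ => contDiff_const⟩

theorem IsSmooth.add (hR : IsSmooth R) (hT : IsSmooth T) : IsSmooth (R + T) :=
  ⟨fun c hc => (hR.convenient c hc).add (hT.convenient c hc),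
    fun φ ε hε => (hR.contDiff_net φ ε hε).add (hT.contDiff_net φ ε hε)⟩

theorem IsSmooth.mul (hR : IsSmooth R) (hT : IsSmooth T) : IsSmooth (R * T) :=
  ⟨fun c hc => (hR.convenient c hc).mul (hT.convenient c hc),
    fun φ ε hε => (hR.contDiff_net φ ε hε).mul (hT.contDiff_net φ ε hε)⟩

theorem IsModerate.exists_le (hR : IsModerate R) (hK : IsCompact K) (k : ℕ) :
    ∃ N : ℕ, ∀ φ ∈ momentClass n N, ∀ i ≤ k, DerivBound R K φ i (-(N : ℤ)) := by
  choose N hN using hR.bound K hK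
  refine ⟨∑ i ∈ Finset.range (k + 1), N i, fun φ hφ i hi => ?_⟩
  have h : N i ≤ ∑ i ∈ Finset.range (k + 1), N i :=
    Finset.single_le_sum (fun _ _ => Nat.zero_le _) (Finset.mem_range.2 (Nat.lt_succ_of_le hi))
  exact (hN i φ (momentClass_anti h hφ)).mono (by omega)

theorem IsNegligible.exists_le (hR : IsNegligible R) (hK : IsCompact K) (k m : ℕ) :
    ∃ q : ℕ, ∀ φ ∈ momentClass n q, ∀ i ≤ k, DerivBound R K φ i m := by
  choose N hN using fun k => hR K hK k m
  refine ⟨∑ i ∈ Finset.range (k + 1), N i, fun φ hφ i hi => ?_⟩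
  have h : N i ≤ ∑ i ∈ Finset.range (k + 1), N i :=
    Finset.single_le_sum (fun _ _ => Nat.zero_le _) (Finset.mem_range.2 (Nat.lt_succ_of_le hi))
  exact hN i φ (momentClass_anti h hφ)

theorem IsModerate.const (c : ℂ) : IsModerate (fun _ : RealTest n => c) := by
  refine ⟨IsSmooth.const c, fun K _ k => ⟨0, fun φ _ => ⟨‖c‖, Eventually.of_forall fun ε x _ => ?_⟩⟩⟩
  rcases k with _ | k
  · simp
  · rw [iteratedFDeriv_const_of_ne (Nat.succ_ne_zero k)]
    simp

theorem IsModerate.add (hR : IsModerate R) (hT : IsModerate T) : IsModerate (R + T) := by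
  refine ⟨hR.smooth.add hT.smooth, fun K hK k => ?_⟩
  obtain ⟨N, hN⟩ := hR.bound K hK k
  obtain ⟨M, hM⟩ := hT.bound K hK k
  refine ⟨N + M, fun φ hφ => DerivBound.add hR.smooth hT.smooth ?_ ?_⟩
  · exact (hN φ (momentClass_anti (by omega) hφ)).mono (by omega)
  · exact (hM φ (momentClass_anti (by omega) hφ)).mono (by omega)

theorem IsModerate.mul (hR : IsModerate R) (hT : IsModerate T) : IsModerate (R * T) := by
  refine ⟨hR.smooth.mul hT.smooth, fun K hK k => ?_⟩
  obtain ⟨N, hN⟩ := hR.exists_le hK k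
  obtain ⟨M, hM⟩ := hT.exists_le hK k
  refine ⟨N + M, fun φ hφ => ?_⟩
  refine (DerivBound.mul hR.smooth hT.smooth (hN φ (momentClass_anti (by omega) hφ))
    (hM φ (momentClass_anti (by omega) hφ))).mono (by omega)

theorem IsNegligible.mul_left (hR : IsModerate R) (hT : IsModerate T) (h : IsNegligible T) :
    IsNegligible (R * T) := by
  intro K hK k m
  obtain ⟨N, hN⟩ := hR.exists_le hK k
  obtain ⟨q, hq⟩ := h.exists_le hK k (m + N)
  refine ⟨N + q, fun φ hφ => ?_⟩
  refine (DerivBound.mul hR.smooth hT.smooth (hN φ (momentClass_anti (by omega) hφ))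
    (hq φ (momentClass_anti (by omega) hφ))).mono (by push_cast; omega)

end Bounds

/-- The algebra of moderate functions. -/
def moderate (n : ℕ) : Subalgebra ℂ (RealTest n → ℂ) where
  carrier := {R | IsModerate R}
  mul_mem' := IsModerate.mul
  add_mem' := IsModerate.add
  algebraMap_mem' := IsModerate.const

/-- The ideal of negligible functions in the algebra of moderate functions. -/
def negligible (n : ℕ) : Ideal (moderate n) where
  carrier := {R | IsNegligible (R : RealTest n → ℂ)}
  add_mem' := by
    intro R T hR hT K hK k m
    obtain ⟨p, hp⟩ := hR K hK k m
    obtain ⟨q, hq⟩ := hT K hK k m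
    exact ⟨p + q, fun φ hφ => DerivBound.add R.2.smooth T.2.smooth
      (hp φ (momentClass_anti (by omega) hφ)) (hq φ (momentClass_anti (by omega) hφ))⟩
  zero_mem' := by
    intro K _ k m
    refine ⟨0, fun φ _ => ⟨0, Eventually.of_forall fun ε x _ => ?_⟩⟩
    have : (fun y => ((0 : moderate n) : RealTest n → ℂ) (deltaNet φ ε y)) = 0 := rfl
    rw [this, iteratedFDeriv_zero]
    simp
  smul_mem' := fun R T hT => IsNegligible.mul_left R.2 T.2 hT

/-- The algebra of Colombeau generalized functions on `ℝⁿ`. -/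
abbrev GeneralizedFunction (n : ℕ) : Type := moderate n ⧸ negligible n

/-- The generalized function `G` is the class of the function `R` on real test functions. -/
def IsClassOf (G : GeneralizedFunction n) (R : RealTest n → ℂ) : Prop :=
  ∃ h : R ∈ moderate n, G = Ideal.Quotient.mk (negligible n) ⟨R, h⟩

end Colombeau

/-! ## Completeness of the Schwartz space -/

namespace SchwartzMap

open scoped ContDiff

variable {E F : Type*} [NormedAddCommGroup E] [NormedSpace ℝ E] [NormedAddCommGroup F]
  [NormedSpace ℝ F] [CompleteSpace F]

/-! Both functions have the form `φ ↦ E[exp (i ⟨u, φ⟩)]` for a probability measure `ν` of polynomial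
growth. For each order `m` such a function factors as `Φ ∘ T`, where `T ψ = ⟨·, ψ⟩` is linear from
Schwartz space to `Lᵐ⁺¹(ν)` and `Φ X = E[exp (i X)]`.

Polynomial growth says that `T` takes values in `Lᵐ⁺¹`. Its continuity (`evalLM_continuous`) comes
from Baire's theorem: `ψ ↦ ‖T ψ‖` is a lower semicontinuous seminorm by Fatou, and Schwartz space is
Fréchet. This is what completeness is for.

`Φ` is `Cᵐ` with bounded derivatives (`contDiff_expLp`): differentiating `exp (i X)` brings down one
factor of the increment, which Hölder's inequality pays for with one factor `Lᵐ⁺¹`, while `exp (i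
X)` itself stays bounded.

Hence `Φ ∘ T` is `Cᵐ` along smooth curves for every `m`. Along `φ_{ε,x}`, the `x`-derivatives of `T`
are controlled by a Schwartz seminorm of `φ_{ε,0}`, which grows at most like a power of `1/ε`. As
the derivatives of `Φ` are bounded, Faà di Bruno's formula gives moderateness. -/

theorem exists_eq_tsum {ι : Type*} (v : ι → 𝓢(E, F))
    (hv : ∀ k l, Summable fun i => SchwartzMap.seminorm ℝ k l (v i)) :
    ∃ g : 𝓢(E, F), (∀ x, g x = ∑' i, v i x) ∧
      ∀ k l, SchwartzMap.seminorm ℝ k l g ≤ ∑' i, SchwartzMap.seminorm ℝ k l (v i) := by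
  have h1 : ∀ (l : ℕ) (i : ι) (x : E), (l : ℕ∞) ≤ ⊤ →
      ‖iteratedFDeriv ℝ l (v i) x‖ ≤ SchwartzMap.seminorm ℝ 0 l (v i) :=
    fun l i x _ => norm_iteratedFDeriv_le_seminorm ℝ (v i) l x
  have h2 : ∀ (k l : ℕ) (x : E), ‖x‖ ^ k * ‖iteratedFDeriv ℝ l (fun y => ∑' i, v i y) x‖ ≤
      ∑' i, SchwartzMap.seminorm ℝ k l (v i) := by
    intro k l x
    rw [iteratedFDeriv_tsum_apply (N := ⊤) (fun i => (v i).smooth ⊤) (fun l _ => hv 0 l) h1 le_top]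
    have h3 : Summable fun i => ‖iteratedFDeriv ℝ l (v i) x‖ :=
      (hv 0 l).of_nonneg_of_le (fun _ => norm_nonneg _) fun i => h1 l i x le_top
    calc ‖x‖ ^ k * ‖∑' i, iteratedFDeriv ℝ l (v i) x‖
        ≤ ‖x‖ ^ k * ∑' i, ‖iteratedFDeriv ℝ l (v i) x‖ := by
          gcongr
          exact norm_tsum_le_tsum_norm h3
      _ = ∑' i, ‖x‖ ^ k * ‖iteratedFDeriv ℝ l (v i) x‖ := tsum_mul_left.symm
      _ ≤ _ := (h3.mul_left _).tsum_le_tsum (fun i => le_seminorm ℝ k l (v i) x) (hv k l)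
  refine ⟨⟨fun x => ∑' i, v i x, ?_, fun k l => ⟨_, h2 k l⟩⟩, fun _ => rfl, fun k l => ?_⟩
  · exact contDiff_tsum (N := ⊤) (fun i => (v i).smooth ⊤) (fun l _ => hv 0 l) h1
  · exact seminorm_le_bound ℝ k l _ (tsum_nonneg fun i => apply_nonneg _ _) (h2 k l)

theorem exists_hasSum {ι : Type*} (v : ι → 𝓢(E, F))
    (hv : ∀ k l, Summable fun i => SchwartzMap.seminorm ℝ k l (v i)) : ∃ g, HasSum v g := by
  obtain ⟨g, hg, -⟩ := exists_eq_tsum v hv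
  refine ⟨g, ((schwartz_withSeminorms ℝ E F).tendsto_nhds _ _).2 fun ⟨k, l⟩ ε hε => ?_⟩
  filter_upwards [(tendsto_tsum_compl_atTop_zero
    fun i => SchwartzMap.seminorm ℝ k l (v i)).eventually_lt_const hε] with s hs
  obtain ⟨r, hr, hr'⟩ := exists_eq_tsum (fun i : {i // i ∉ s} => v i)
    fun k l => (hv k l).subtype _
  -- The error of a partial sum is, up to sign, the sum of the omitted terms, so its seminorm is at
  -- most the tail of a convergent series.
  have h : ∑ i ∈ s, v i - g = -r := by
    ext x
    have hsum : Summable fun i => v i x :=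
      .of_norm_bounded (hv 0 0) fun i => norm_le_seminorm ℝ (v i) x
    have := hsum.sum_add_tsum_compl (s := s)
    simp only [sub_apply, sum_apply, neg_apply, hg, hr, ← this]
    simp only [sub_add_cancel_left]
    rfl
  rw [h, map_neg_eq_map]
  exact (hr' k l).trans_lt hs

instance : (uniformity 𝓢(E, F)).IsCountablyGenerated :=
  IsUniformAddGroup.uniformity_countably_generated

/-- It suffices to treat sequences whose increments are below `2⁻ᴺ` in the `N`-th seminorm; these
telescope to absolutely convergent series. -/
instance : CompleteSpace 𝓢(E, F) := by
  let p : ℕ → Seminorm ℝ 𝓢(E, F) := fun N => (Finset.Iic (N, N)).sup (schwartzSeminormFamily ℝ E F)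
  have hp : ∀ N, Continuous (p N) := fun N =>
    Seminorm.continuous_finsetSup fun i _ => (schwartz_withSeminorms ℝ E F).continuous_seminorm i
  refine UniformSpace.complete_of_convergent_controlled_sequences
    (fun N => {q | p N (q.2 - q.1) < (1 / 2) ^ N}) (fun N => ?_) fun u hu => ?_
  · rw [uniformity_eq_comap_nhds_zero]
    refine ⟨{f | p N f < (1 / 2) ^ N}, ?_, fun _ h => h⟩
    exact (hp N).continuousAt.eventually_lt continuousAt_const (by simp)
  · obtain ⟨g, hg⟩ := exists_hasSum (fun j => u (j + 1) - u j) fun k l => by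
      -- The seminorm with indices `k, l` is dominated by `p N` only for `N ≥ max k l`, so the first
      -- terms are dropped.
      refine (summable_nat_add_iff (max k l)).1 ?_
      refine ((summable_nat_add_iff (max k l)).2
        (summable_geometric_of_lt_one (r := (1 / 2 : ℝ)) (by norm_num)
          (by norm_num))).of_nonneg_of_le (fun _ => apply_nonneg _ _) fun j => ?_
      refine le_trans ?_ (hu (j + max k l) (j + max k l) (j + max k l + 1) le_rfl (by omega)).le
      have hmem : (k, l) ∈ Finset.Iic (j + max k l, j + max k l) := by
        simp only [Finset.mem_Iic, Prod.mk_le_mk]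
        omega
      exact Seminorm.le_def.1 (Finset.le_sup (f := schwartzSeminormFamily ℝ E F) hmem) _
    refine ⟨g + u 0, ?_⟩
    have := hg.tendsto_sum_nat.add_const (u 0)
    simpa only [Finset.sum_range_sub, sub_add_cancel] using this

end SchwartzMap

/-! ## Evaluation on Schwartz functions as a map to `Lᵖ` -/

section Evaluation

variable {n : ℕ} {ν : Measure (RealTempered n)}

theorem RealTempered.continuous_eval (ψ : 𝓢(RSpace n, ℝ)) :
    Continuous fun u : RealTempered n => u ψ := by
  fun_prop

theorem HasPolynomialGrowth.memLp (h : HasPolynomialGrowth ν) (p : ℕ) (ψ : 𝓢(RSpace n, ℝ)) :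
    MemLp (fun u : RealTempered n => u ψ) p ν := by
  have hm : AEStronglyMeasurable (fun u : RealTempered n => u ψ) ν :=
    (RealTempered.continuous_eval ψ).measurable.aestronglyMeasurable
  rcases eq_or_ne p 0 with rfl | hp
  · simpa using hm
  · rw [← integrable_norm_rpow_iff hm (by simpa using hp) (by simp)]
    simpa using (h p fun _ => ψ).norm

/-- The evaluation of temperate distributions at Schwartz functions, as a linear map to `Lᵖ`. -/
noncomputable def evalLM (h : HasPolynomialGrowth ν) (p : ℕ) :
    𝓢(RSpace n, ℝ) →ₗ[ℝ] Lp ℝ p ν where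
  toFun ψ := (h.memLp p ψ).toLp
  map_add' ψ ψ' := by
    rw [← MemLp.toLp_add]
    congr 1
    ext u
    simp
  map_smul' c ψ := by
    rw [RingHom.id_apply, ← MemLp.toLp_const_smul]
    congr 1
    ext u
    simp

/-- A lower semicontinuous seminorm on a barrelled space is continuous, and a complete metrizable
space is barrelled. The closed sublevel sets come from Fatou's lemma, since `ψⱼ → ψ` gives `u ψⱼ → u
ψ` for each `u`. -/
theorem evalLM_continuous (h : HasPolynomialGrowth ν) (p : ℕ) [Fact (1 ≤ (p : ℝ≥0∞))] :
    Continuous (evalLM h p) := by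
  have key : Continuous ((normSeminorm ℝ (Lp ℝ p ν)).comp (evalLM h p)) := by
    refine Seminorm.continuous_of_lowerSemicontinuous _ ?_
    refine lowerSemicontinuous_iff_isClosed_preimage.2 fun c => ?_
    refine IsSeqClosed.isClosed fun ψ ψ₀ hψ hlim => ?_
    have hc : 0 ≤ c := (norm_nonneg (evalLM h p (ψ 0))).trans (hψ 0)
    have hle : ∀ j, eLpNorm (fun u : RealTempered n => u (ψ j)) p ν ≤ ENNReal.ofReal c := by
      intro j
      have : ‖(h.memLp p (ψ j)).toLp‖ ≤ c := hψ j
      rw [Lp.norm_toLp] at this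
      exact (ENNReal.le_ofReal_iff_toReal_le (h.memLp p (ψ j)).2.ne hc).2 this
    change ‖(h.memLp p ψ₀).toLp‖ ≤ c
    rw [Lp.norm_toLp]
    refine ENNReal.toReal_le_of_le_ofReal hc ?_
    refine (Lp.eLpNorm_lim_le_liminf_eLpNorm (fun j => (h.memLp p (ψ j)).1) _
      (ae_of_all _ fun u => (u.continuous.tendsto ψ₀).comp hlim)).trans ?_
    exact liminf_le_of_frequently_le' (Frequently.of_forall hle)
  exact (norm_withSeminorms ℝ _).continuous_of_continuous_comp _ fun _ => key

end Evaluation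

/-! ## The exponential `X ↦ exp (i X)` on `Lᵖ` -/

section Exponential

/-- Taylor's estimate covers `|h| ≤ 1`. For `|h| ≥ 1` the left side is at most `2|h| ≤ 2h²`. The
bound is needed for all `h`, because an element of `Lᵖ` need not be bounded. -/
theorem Complex.norm_exp_I_mul_sub_one_sub_le (h : ℝ) :
    ‖Complex.exp (Complex.I * h) - 1 - Complex.I * h‖ ≤ 2 * (‖h‖ * ‖h‖) := by
  have hn : ‖Complex.I * (h : ℂ)‖ = ‖h‖ := by simp
  rcases le_total ‖h‖ 1 with h1 | h1
  · have := Complex.norm_exp_sub_one_sub_id_le (hn.trans_le h1)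
    rw [hn] at this
    nlinarith [norm_nonneg h]
  · have h2 := norm_sub_le (Complex.exp (Complex.I * h) - 1) (Complex.I * h)
    have h3 := Real.norm_exp_I_mul_ofReal_sub_one_le (x := h)
    nlinarith

variable {Ω : Type*} [MeasurableSpace Ω] {ν : Measure Ω} {p q r : ℝ≥0∞}

theorem memLp_exp_I_mul [IsFiniteMeasure ν] (q : ℝ≥0∞) {X : Ω → ℝ}
    (hX : AEStronglyMeasurable X ν) :
    MemLp (fun u => Complex.exp (Complex.I * (X u : ℝ))) q ν := by
  refine MemLp.of_bound ?_ 1 (ae_of_all _ fun u => ?_)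
  · exact (by fun_prop : Continuous fun x : ℝ => Complex.exp (Complex.I * x)).comp_aestronglyMeasurable
      hX
  · rw [mul_comm, Complex.norm_exp_ofReal_mul_I]

/-- The map `X ↦ exp (i X)` from `Lᵖ` to `L^q`. -/
noncomputable def expLp [IsFiniteMeasure ν] (p q : ℝ≥0∞) (X : Lp ℝ p ν) : Lp ℂ q ν :=
  (memLp_exp_I_mul q (Lp.aestronglyMeasurable X)).toLp

theorem coeFn_expLp [IsFiniteMeasure ν] (X : Lp ℝ p ν) :
    expLp p q X =ᵐ[ν] fun u => Complex.exp (Complex.I * (X u : ℝ)) :=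
  MemLp.coeFn_toLp _

theorem norm_expLp_le [IsProbabilityMeasure ν] [Fact (1 ≤ q)] (X : Lp ℝ p ν) :
    ‖expLp p q X‖ ≤ 1 := by
  refine (Lp.norm_le_of_ae_bound zero_le_one ?_).trans_eq ?_
  · filter_upwards [coeFn_expLp (q := q) X] with u hu
    rw [hu, mul_comm, Complex.norm_exp_ofReal_mul_I]
  · simp [measureUnivNNReal]

theorem norm_expLp_sub_le [IsFiniteMeasure ν] (X Y : Lp ℝ p ν) :
    ‖expLp p p X - expLp p p Y‖ ≤ ‖X - Y‖ := by
  refine Lp.norm_le_norm_of_ae_le ?_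
  filter_upwards [coeFn_expLp (q := p) X, coeFn_expLp (q := p) Y, Lp.coeFn_sub X Y,
    Lp.coeFn_sub (expLp p p X) (expLp p p Y)] with u h1 h2 h3 h4
  rw [h3, h4, Pi.sub_apply, Pi.sub_apply, h1, h2]
  have e : Complex.exp (Complex.I * (X u : ℝ)) - Complex.exp (Complex.I * (Y u : ℝ)) =
      Complex.exp ((Y u : ℝ) * Complex.I) *
        (Complex.exp (Complex.I * ((X u - Y u : ℝ) : ℂ)) - 1) := by
    rw [mul_sub, ← Complex.exp_add, mul_one]
    push_cast
    ring_nf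
  rw [e, norm_mul, Complex.norm_exp_ofReal_mul_I, one_mul]
  exact Real.norm_exp_I_mul_ofReal_sub_one_le

/-- The bilinear map `(h, z) ↦ i h z`. -/
noncomputable def mulIBilin : ℝ →L[ℝ] ℂ →L[ℝ] ℂ :=
  (ContinuousLinearMap.mul ℝ ℂ).comp (Complex.I • Complex.ofRealCLM)

theorem mulIBilin_apply (h : ℝ) (z : ℂ) : mulIBilin h z = Complex.I * h * z := rfl

/-- Pointwise the remainder is at most `2 |Y - X|²`. Hölder bounds this square in `L^{p/2}`, and
`hq` says `q ≤ p/2`, so on a probability space the `L^q` norm is no larger. -/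
theorem norm_expLp_sub_sub_le [IsProbabilityMeasure ν] [Fact (1 ≤ p)] [Fact (1 ≤ q)]
    [Fact (1 ≤ r)] [ENNReal.HolderTriple p r q] (hq : p⁻¹ + p⁻¹ ≤ q⁻¹) (X Y : Lp ℝ p ν) :
    ‖expLp p q Y - expLp p q X - mulIBilin.holderL ν p r q (Y - X) (expLp p r X)‖ ≤
      2 * ‖Y - X‖ ^ 2 := by
  set Z := expLp p q Y - expLp p q X - mulIBilin.holderL ν p r q (Y - X) (expLp p r X)
  have hZ : ∀ᵐ u ∂ν, ‖Z u‖ ≤ ‖(2 * ((Y - X) u * (Y - X) u) : ℝ)‖ := by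
    filter_upwards [coeFn_expLp (q := q) X, coeFn_expLp (q := q) Y, coeFn_expLp (q := r) X,
      Lp.coeFn_sub Y X, Lp.coeFn_sub (expLp p q Y) (expLp p q X),
      Lp.coeFn_sub (expLp p q Y - expLp p q X)
        (mulIBilin.holderL ν p r q (Y - X) (expLp p r X)),
      mulIBilin.coeFn_holder (r := q) (Y - X) (expLp p r X)] with u h1 h2 h3 h4 h5 h6 h7
    rw [h6, Pi.sub_apply, h5, Pi.sub_apply, h1, h2, ContinuousLinearMap.holderL_apply_apply, h7,
      h3, h4, mulIBilin_apply, Pi.sub_apply]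
    have e : Complex.exp (Complex.I * (Y u : ℝ)) - Complex.exp (Complex.I * (X u : ℝ)) -
        Complex.I * ((Y u - X u : ℝ) : ℂ) * Complex.exp (Complex.I * (X u : ℝ)) =
        Complex.exp ((X u : ℝ) * Complex.I) *
        (Complex.exp (Complex.I * ((Y u - X u : ℝ) : ℂ)) - 1 -
          Complex.I * ((Y u - X u : ℝ) : ℂ)) := by
      rw [mul_sub, mul_sub, ← Complex.exp_add, mul_one]
      push_cast
      ring_nf
    rw [e, norm_mul, Complex.norm_exp_ofReal_mul_I, one_mul, norm_mul, norm_mul, Real.norm_two]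
    exact Complex.norm_exp_I_mul_sub_one_sub_le _
  have hm := Lp.aestronglyMeasurable (Y - X)
  have hpp : ENNReal.HolderTriple p p (p⁻¹ + p⁻¹)⁻¹ := ⟨by rw [inv_inv]⟩
  have h1 : eLpNorm Z q ν ≤ 2 * eLpNorm (Y - X : Lp ℝ p ν) p ν * eLpNorm (Y - X : Lp ℝ p ν) p ν := by
    refine (eLpNorm_mono_ae hZ).trans ?_
    refine (eLpNorm_le_eLpNorm_of_exponent_le (ENNReal.le_inv_iff_le_inv.2 hq) ?_).trans ?_
    · exact (hm.mul hm).const_mul _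
    · exact eLpNorm_le_eLpNorm_mul_eLpNorm_of_nnnorm hm hm (fun a b : ℝ => 2 * (a * b)) 2
        (ae_of_all _ fun u => by simp [nnnorm_mul, mul_assoc])
  have hfin := (Lp.memLp (Y - X)).2.ne
  rw [Lp.norm_def, Lp.norm_def]
  refine (ENNReal.toReal_mono (by finiteness) h1).trans_eq ?_
  simp only [ENNReal.toReal_mul, ENNReal.toReal_ofNat]
  ring

theorem hasFDerivAt_expLp [IsProbabilityMeasure ν] [Fact (1 ≤ p)] [Fact (1 ≤ q)]
    [Fact (1 ≤ r)] [ENNReal.HolderTriple p r q] (hq : p⁻¹ + p⁻¹ ≤ q⁻¹) (X : Lp ℝ p ν) :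
    HasFDerivAt (expLp p q) ((mulIBilin.holderL ν p r q).flip (expLp p r X)) X := by
  refine HasFDerivAt.of_isLittleO ?_
  have h1 : (fun Y => expLp p q Y - expLp p q X -
      (mulIBilin.holderL ν p r q).flip (expLp p r X) (Y - X)) =O[𝓝 X]
        fun Y => ‖Y - X‖ ^ 2 := by
    refine Asymptotics.isBigO_of_le' (c := 2) _ fun Y => ?_
    rw [norm_pow, norm_norm]
    exact norm_expLp_sub_sub_le hq X Y
  refine h1.trans_isLittleO ?_
  exact (Asymptotics.isLittleO_norm_pow_id one_lt_two).comp_tendsto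
    ((continuous_id.sub continuous_const).tendsto' X 0 (sub_self X))

/-- The derivative of `expLp p q` at `X` is `h ↦ i h exp (i X)`: a fixed continuous linear map
applied to `expLp p r X`, with `1/r = 1/q - 1/p`. Induction applies to `expLp p r`, and the bounds
follow since `exp (i X)` has norm at most one. At `m = 0` the map is Lipschitz from `Lᵖ` to itself.
-/
theorem contDiff_expLp [IsProbabilityMeasure ν] [Fact (1 ≤ p)] (m : ℕ) :
    ∀ q : ℝ≥0∞, [Fact (1 ≤ q)] → q⁻¹ = (m + 1) * p⁻¹ →
      ContDiff ℝ m (expLp (ν := ν) p q) ∧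
        ∀ k ≤ m, ∃ C, ∀ X, ‖iteratedFDeriv ℝ k (expLp (ν := ν) p q) X‖ ≤ C := by
  have h0 : ∀ q : ℝ≥0∞, [Fact (1 ≤ q)] →
      ∃ C, ∀ X, ‖iteratedFDeriv ℝ 0 (expLp (ν := ν) p q) X‖ ≤ C := fun q _ =>
    ⟨1, fun X => by rw [norm_iteratedFDeriv_zero]; exact norm_expLp_le X⟩
  induction m with
  | zero =>
    intro q _ hq
    obtain rfl : q = p := by simpa using hq
    refine ⟨?_, fun k hk => ?_⟩
    · rw [Nat.cast_zero, contDiff_zero]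
      exact (LipschitzWith.of_dist_le_mul (K := 1) fun X Y => by
        simpa [dist_eq_norm] using norm_expLp_sub_le X Y).continuous
    · obtain rfl := Nat.le_zero.1 hk
      exact h0 q
  | succ m ih =>
    intro q hq1 hq
    set r : ℝ≥0∞ := ((m + 1) * p⁻¹)⁻¹ with hr
    have hrq : p⁻¹ + r⁻¹ = q⁻¹ := by
      rw [hr, inv_inv, hq]
      push_cast
      ring
    have hr1 : Fact (1 ≤ r) := ⟨by
      rw [← ENNReal.inv_le_one]
      exact (le_add_self.trans_eq hrq).trans (ENNReal.inv_le_one.2 hq1.out)⟩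
    have : ENNReal.HolderTriple p r q := ⟨hrq⟩
    -- Here `1/q = (m + 2)/p`, which leaves room for the quadratic remainder.
    have hpq : p⁻¹ + p⁻¹ ≤ q⁻¹ := by
      rw [← hrq, hr, inv_inv]
      gcongr
      exact le_mul_of_one_le_left zero_le le_add_self
    obtain ⟨ihc, ihb⟩ := ih r (by rw [hr, inv_inv])
    set L := (mulIBilin.holderL ν p r q).flip
    have hd : ∀ X, HasFDerivAt (expLp p q) (L (expLp p r X)) X := hasFDerivAt_expLp hpq
    have hf : fderiv ℝ (expLp (ν := ν) p q) = L ∘ expLp p r := funext fun X => (hd X).fderiv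
    refine ⟨contDiff_succ_iff_hasFDerivAt.2 ⟨_, L.contDiff.comp ihc, hd⟩, fun k hk => ?_⟩
    rcases k with _ | k
    · exact h0 q
    · obtain ⟨C, hC⟩ := ihb k (by omega)
      refine ⟨‖L‖ * C, fun X => ?_⟩
      rw [← norm_iteratedFDeriv_fderiv, hf]
      refine (L.norm_iteratedFDeriv_comp_left ihc.contDiffAt
        (by exact_mod_cast (by omega : k ≤ m))).trans ?_
      gcongr
      exact hC X

/-- The map `X ↦ E[exp (i X)]` on `Lᵐ⁺¹` has `m` bounded derivatives. -/
theorem contDiff_integral_exp [IsProbabilityMeasure ν] (m : ℕ)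
    [Fact (1 ≤ ((m + 1 : ℕ) : ℝ≥0∞))] :
    ContDiff ℝ m (fun X : Lp ℝ (m + 1 : ℕ) ν => ∫ u, Complex.exp (Complex.I * (X u : ℝ)) ∂ν) ∧
      ∃ C, ∀ k ≤ m, ∀ X, ‖iteratedFDeriv ℝ k (fun X : Lp ℝ (m + 1 : ℕ) ν =>
        ∫ u, Complex.exp (Complex.I * (X u : ℝ)) ∂ν) X‖ ≤ C := by
  -- With `p = m + 1` the target exponent is exactly `1`, where the integral is a continuous linear
  -- functional.
  obtain ⟨h1, h2⟩ := contDiff_expLp (ν := ν) (p := (m + 1 : ℕ)) m 1 (by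
    rw [inv_one, ← Nat.cast_succ, ENNReal.mul_inv_cancel (by simp) (by simp)])
  have e : (fun X : Lp ℝ (m + 1 : ℕ) ν => ∫ u, Complex.exp (Complex.I * (X u : ℝ)) ∂ν) =
      (L1.integralCLM : Lp ℂ 1 ν →L[ℝ] ℂ) ∘ expLp _ 1 := by
    ext X
    rw [Function.comp_apply, ← L1.integral_eq, L1.integral_eq_integral]
    exact integral_congr_ae (coeFn_expLp X).symm
  rw [e]
  refine ⟨(L1.integralCLM : Lp ℂ 1 ν →L[ℝ] ℂ).contDiff.comp h1, ?_⟩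
  choose! C hC using h2
  refine ⟨∑ k ∈ Finset.range (m + 1), ‖(L1.integralCLM : Lp ℂ 1 ν →L[ℝ] ℂ)‖ * |C k|,
    fun k hk X => ?_⟩
  refine (ContinuousLinearMap.norm_iteratedFDeriv_comp_left _ h1.contDiffAt
    (by exact_mod_cast hk)).trans ?_
  refine le_trans ?_ (Finset.single_le_sum (fun i _ => by positivity)
    (Finset.mem_range.2 (Nat.lt_succ_of_le hk)))
  gcongr
  exact (hC k hk X).trans (le_abs_self _)

end Exponential

/-! ## Translations of Schwartz functions -/

namespace SchwartzMap

open scoped ContDiff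
open LineDeriv

variable {E F V : Type*} [NormedAddCommGroup E] [NormedSpace ℝ E] [NormedAddCommGroup F]
  [NormedSpace ℝ F] [NormedAddCommGroup V] [NormedSpace ℝ V]

/-- The seminorm of order `s`, which bounds `s` derivatives with weights of order `s`. -/
noncomputable def orderSeminorm (s : ℕ) : Seminorm ℝ 𝓢(E, F) :=
  (Finset.Iic (s, s)).sup (schwartzSeminormFamily ℝ E F)

theorem seminorm_le_orderSeminorm {s k l : ℕ} (hk : k ≤ s) (hl : l ≤ s) (f : 𝓢(E, F)) :
    SchwartzMap.seminorm ℝ k l f ≤ orderSeminorm s f :=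
  Seminorm.le_def.1 (Finset.le_sup (f := schwartzSeminormFamily ℝ E F)
    (Finset.mem_Iic.2 (Prod.mk_le_mk.2 ⟨hk, hl⟩))) f

theorem orderSeminorm_le {s : ℕ} {f : 𝓢(E, F)} {M : ℝ} (hM : 0 ≤ M)
    (h : ∀ k ≤ s, ∀ l ≤ s, SchwartzMap.seminorm ℝ k l f ≤ M) : orderSeminorm s f ≤ M :=
  Seminorm.finset_sup_apply_le hM fun i hi =>
    h i.1 (Finset.mem_Iic.1 hi).1 i.2 (Finset.mem_Iic.1 hi).2

theorem orderSeminorm_mono {s t : ℕ} (h : s ≤ t) (f : 𝓢(E, F)) :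
    orderSeminorm s f ≤ orderSeminorm t f :=
  orderSeminorm_le (apply_nonneg _ _) fun _ hk _ hl =>
    seminorm_le_orderSeminorm (hk.trans h) (hl.trans h) f

theorem one_add_pow_mul_le_orderSeminorm {s k l : ℕ} (hk : k ≤ s) (hl : l ≤ s) (f : 𝓢(E, F))
    (x : E) : (1 + ‖x‖) ^ k * ‖iteratedFDeriv ℝ l f x‖ ≤ 2 ^ s * orderSeminorm s f :=
  one_add_le_sup_seminorm_apply (𝕜 := ℝ) (m := (s, s)) hk hl f x

/-- Continuity involves finitely many seminorms; `s` is the largest index among them. -/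
theorem exists_norm_le_orderSeminorm (T : 𝓢(E, F) →L[ℝ] V) :
    ∃ (s : ℕ) (C : ℝ), 0 ≤ C ∧ ∀ f, ‖T f‖ ≤ C * orderSeminorm s f := by
  obtain ⟨t, C, -, h⟩ := Seminorm.bound_of_continuous (schwartz_withSeminorms ℝ E F)
    ((normSeminorm ℝ V).comp T.toLinearMap) (continuous_norm.comp T.continuous)
  refine ⟨t.sup fun i => max i.1 i.2, C, C.2, fun f => (Seminorm.le_def.1 h f).trans ?_⟩
  refine mul_le_mul_of_nonneg_left ?_ C.2
  refine Seminorm.finset_sup_apply_le (apply_nonneg _ _) fun i hi => ?_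
  have := Finset.le_sup (f := fun i : ℕ × ℕ => max i.1 i.2) hi
  exact seminorm_le_orderSeminorm ((le_max_left _ _).trans this) ((le_max_right _ _).trans this) f

theorem orderSeminorm_lineDerivOp_le (s : ℕ) (v : E) (f : 𝓢(E, F)) :
    orderSeminorm s (∂_{v} f) ≤ ‖v‖ * orderSeminorm (s + 1) f := by
  have h0 : 0 ≤ ‖v‖ * orderSeminorm (s + 1) f := mul_nonneg (norm_nonneg _) (apply_nonneg _ _)
  refine orderSeminorm_le h0 fun k hk l hl => seminorm_le_bound ℝ k l _ h0 fun x => ?_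
  have h1 : ‖iteratedFDeriv ℝ l (∂_{v} f : 𝓢(E, F)) x‖ ≤ ‖v‖ * ‖iteratedFDeriv ℝ (l + 1) f x‖ := by
    rw [← norm_iteratedFDeriv_fderiv]
    exact norm_iteratedFDeriv_clm_apply_const (N := ∞)
      ((f.smooth ⊤).fderiv_right (by simp)).contDiffAt (mod_cast le_top)
  calc ‖x‖ ^ k * ‖iteratedFDeriv ℝ l (∂_{v} f : 𝓢(E, F)) x‖
      ≤ ‖x‖ ^ k * (‖v‖ * ‖iteratedFDeriv ℝ (l + 1) f x‖) := by gcongr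
    _ = ‖v‖ * (‖x‖ ^ k * ‖iteratedFDeriv ℝ (l + 1) f x‖) := by ring
    _ ≤ _ := by
      gcongr
      exact (le_seminorm ℝ k (l + 1) f x).trans
        (seminorm_le_orderSeminorm (by omega) (by omega) f)

theorem iteratedFDeriv_compSubConstCLM (l : ℕ) (a : E) (f : 𝓢(E, F)) (x : E) :
    iteratedFDeriv ℝ l (compSubConstCLM ℝ a f) x = iteratedFDeriv ℝ l f (x - a) := by
  have := iteratedFDeriv_comp_add_right (𝕜 := ℝ) (f := f) l (-a) x
  simp only [← sub_eq_add_neg] at this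
  exact this

theorem orderSeminorm_compSubConstCLM_le (s : ℕ) (a : E) (f : 𝓢(E, F)) :
    orderSeminorm s (compSubConstCLM ℝ a f) ≤ (1 + ‖a‖) ^ s * (2 ^ s * orderSeminorm s f) := by
  have h0 : 0 ≤ (1 + ‖a‖) ^ s * (2 ^ s * orderSeminorm s f) := by
    have := apply_nonneg (orderSeminorm s) f
    positivity
  refine orderSeminorm_le h0 fun k hk l hl => seminorm_le_bound ℝ k l _ h0 fun x => ?_
  rw [iteratedFDeriv_compSubConstCLM]
  have h1 : ‖x‖ ≤ (1 + ‖a‖) * (1 + ‖x - a‖) := by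
    have := norm_le_norm_sub_add x a
    nlinarith [mul_nonneg (norm_nonneg a) (norm_nonneg (x - a))]
  calc ‖x‖ ^ k * ‖iteratedFDeriv ℝ l f (x - a)‖
      ≤ ((1 + ‖a‖) * (1 + ‖x - a‖)) ^ k * ‖iteratedFDeriv ℝ l f (x - a)‖ := by gcongr
    _ = (1 + ‖a‖) ^ k * ((1 + ‖x - a‖) ^ k * ‖iteratedFDeriv ℝ l f (x - a)‖) := by
        rw [mul_pow]
        ring
    _ ≤ (1 + ‖a‖) ^ s * (2 ^ s * orderSeminorm s f) := by
      gcongr ?_ * ?_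
      · exact pow_le_pow_right₀ (by linarith [norm_nonneg a]) hk
      · exact one_add_pow_mul_le_orderSeminorm hk hl f (x - a)

theorem lineDerivOp_comm (v w : E) (f : 𝓢(E, F)) : ∂_{v} (∂_{w} f) = ∂_{w} (∂_{v} f) := by
  have hd : ∀ x, DifferentiableAt ℝ (fderiv ℝ f) x := fun x =>
    ((f.smooth 2).fderiv_right (m := 1) (by norm_num)).contDiffAt.differentiableAt (by norm_num)
  have h : ∀ (v w x : E), ∂_{v} (∂_{w} f) x = fderiv ℝ (fderiv ℝ f) x v w := fun v w x => by
    change fderiv ℝ (fun y => fderiv ℝ f y w) x v = _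
    rw [fderiv_clm_apply (hd x) (differentiableAt_const w)]
    simp
  ext x
  rw [h, h]
  exact ((f.smooth 2).contDiffAt.isSymmSndFDerivAt (by simp)).eq v w

theorem iteratedLineDerivOp_lineDerivOp_comm {l : ℕ} (m : Fin l → E) (v : E) (f : 𝓢(E, F)) :
    ∂^{m} (∂_{v} f) = ∂_{v} (∂^{m} f) := by
  induction l with
  | zero => rfl
  | succ l ih => rw [iteratedLineDerivOp_succ_left, ih, lineDerivOp_comm,
      ← iteratedLineDerivOp_succ_left]

/-- On the left the derivative along `v` is taken first, on the right last; symmetry of second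
derivatives moves it across the others. -/
theorem iteratedFDeriv_lineDerivOp (l : ℕ) (v : E) (f : 𝓢(E, F)) (x : E) :
    iteratedFDeriv ℝ l (∂_{v} f : 𝓢(E, F)) x = fderiv ℝ (iteratedFDeriv ℝ l f) x v := by
  ext m
  rw [← iteratedLineDerivOp_eq_iteratedFDeriv, iteratedLineDerivOp_lineDerivOp_comm]
  have h := iteratedFDeriv_succ_apply_left (𝕜 := ℝ) (f := f) (x := x) (Fin.cons v m)
  rw [← iteratedLineDerivOp_eq_iteratedFDeriv, iteratedLineDerivOp_succ_left, Fin.cons_zero,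
    Fin.tail_cons] at h
  exact h

theorem differentiable_iteratedFDeriv (l : ℕ) (f : 𝓢(E, F)) :
    Differentiable ℝ (iteratedFDeriv ℝ l f) :=
  (f.smooth ⊤).differentiable_iteratedFDeriv (mod_cast WithTop.coe_lt_top _)

theorem norm_iteratedFDeriv_sub_le {l : ℕ} {f : 𝓢(E, F)} {B : ℝ} {s : Set E} (hs : Convex ℝ s)
    (hB : ∀ z ∈ s, ‖iteratedFDeriv ℝ (l + 1) f z‖ ≤ B) {y z : E} (hy : y ∈ s) (hz : z ∈ s) :
    ‖iteratedFDeriv ℝ l f z - iteratedFDeriv ℝ l f y‖ ≤ B * ‖z - y‖ :=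
  hs.norm_image_sub_le_of_norm_fderiv_le (𝕜 := ℝ)
    (fun x _ => (differentiable_iteratedFDeriv l f).differentiableAt)
    (fun x hx => by rw [norm_fderiv_iteratedFDeriv]; exact hB x hx) hy hz

/-- The mean value inequality is used twice on the ball of radius `‖h‖`: the derivative of
`iteratedFDeriv ℝ l f` varies there by at most `B ‖h‖` from its value at `y`, hence the first-order
remainder is at most `B ‖h‖ · ‖h‖`. -/
theorem norm_iteratedFDeriv_taylor_le {l : ℕ} {f : 𝓢(E, F)} {B : ℝ} {y h : E}
    (hB : ∀ z ∈ Metric.closedBall y ‖h‖, ‖iteratedFDeriv ℝ (l + 2) f z‖ ≤ B) :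
    ‖iteratedFDeriv ℝ l (compSubConstCLM ℝ h f - f + ∂_{h} f) y‖ ≤ B * ‖h‖ ^ 2 := by
  have hc := convex_closedBall y ‖h‖
  have hy : y ∈ Metric.closedBall y ‖h‖ := Metric.mem_closedBall_self (norm_nonneg h)
  have hyh : y - h ∈ Metric.closedBall y ‖h‖ := by simp
  have hB0 : 0 ≤ B := (norm_nonneg _).trans (hB y hy)
  have e : iteratedFDeriv ℝ l (compSubConstCLM ℝ h f - f + ∂_{h} f) y =
      iteratedFDeriv ℝ l f (y - h) - iteratedFDeriv ℝ l f y -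
        fderiv ℝ (iteratedFDeriv ℝ l f) y (y - h - y) := by
    have h1 : ∀ g : 𝓢(E, F), ContDiffAt ℝ l g y := fun g => (g.smooth l).contDiffAt
    have h2 : ⇑(compSubConstCLM ℝ h f - f + ∂_{h} f) =
        (⇑(compSubConstCLM ℝ h f) - ⇑f) + ⇑(∂_{h} f : 𝓢(E, F)) := rfl
    rw [h2, iteratedFDeriv_add_apply (ContDiffAt.sub (h1 _) (h1 _) : ContDiffAt ℝ l (_ - _) y) (h1 _),
      iteratedFDeriv_sub_apply (h1 _) (h1 _), iteratedFDeriv_compSubConstCLM,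
      iteratedFDeriv_lineDerivOp, sub_sub_cancel_left, map_neg, sub_neg_eq_add]
  rw [e]
  refine (hc.norm_image_sub_le_of_norm_hasFDerivWithin_le' (𝕜 := ℝ) (C := B * ‖h‖)
    (fun x _ => (differentiable_iteratedFDeriv l f x).hasFDerivAt.hasFDerivWithinAt)
    (fun x hx => ?_) hy hyh).trans_eq ?_
  · rw [fderiv_iteratedFDeriv, Function.comp_apply, Function.comp_apply, ← dist_eq_norm,
      LinearIsometryEquiv.dist_map, dist_eq_norm]
    refine (norm_iteratedFDeriv_sub_le hc hB hy hx).trans ?_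
    gcongr
    simpa [dist_eq_norm] using hx
  · rw [sub_sub_cancel_left, norm_neg]
    ring

theorem orderSeminorm_taylor_le (s : ℕ) (f : 𝓢(E, F)) {h : E} (hh : ‖h‖ ≤ 1) :
    orderSeminorm s (compSubConstCLM ℝ h f - f + ∂_{h} f) ≤
      2 ^ s * (2 ^ (s + 2) * orderSeminorm (s + 2) f) * ‖h‖ ^ 2 := by
  set M : ℝ := 2 ^ (s + 2) * orderSeminorm (s + 2) f
  have hM : 0 ≤ M := mul_nonneg (by positivity) (apply_nonneg _ _)
  refine orderSeminorm_le (by positivity) fun k hk l hl =>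
    seminorm_le_bound ℝ k l _ (by positivity) fun y => ?_
  have hy : 0 < (1 + ‖y‖) ^ k := by positivity
  have h1 : ∀ z ∈ Metric.closedBall y ‖h‖,
      ‖iteratedFDeriv ℝ (l + 2) f z‖ ≤ 2 ^ s * M / (1 + ‖y‖) ^ k := by
    intro z hz
    rw [le_div_iff₀ hy, mul_comm]
    -- As `‖h‖ ≤ 1`, the weights at `y` and at `z` are comparable, so decay at `z` yields decay at
    -- `y`.
    have h2 : 1 + ‖y‖ ≤ 2 * (1 + ‖z‖) := by
      have h3 := norm_le_norm_add_norm_sub' y z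
      have h4 : ‖y - z‖ ≤ ‖h‖ := by rw [← dist_eq_norm, dist_comm]; exact hz
      linarith [norm_nonneg z]
    calc (1 + ‖y‖) ^ k * ‖iteratedFDeriv ℝ (l + 2) f z‖
        ≤ (2 * (1 + ‖z‖)) ^ k * ‖iteratedFDeriv ℝ (l + 2) f z‖ := by gcongr
      _ = 2 ^ k * ((1 + ‖z‖) ^ k * ‖iteratedFDeriv ℝ (l + 2) f z‖) := by
        rw [mul_pow]
        ring
      _ ≤ 2 ^ s * M := by
        gcongr ?_ * ?_
        · exact pow_le_pow_right₀ one_le_two hk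
        · exact one_add_pow_mul_le_orderSeminorm (by omega) (by omega) f z
  calc ‖y‖ ^ k * ‖iteratedFDeriv ℝ l (compSubConstCLM ℝ h f - f + ∂_{h} f) y‖
      ≤ (1 + ‖y‖) ^ k * (2 ^ s * M / (1 + ‖y‖) ^ k * ‖h‖ ^ 2) := by
        gcongr
        · linarith
        · exact norm_iteratedFDeriv_taylor_le h1
    _ = 2 ^ s * M * ‖h‖ ^ 2 := by field_simp

/-! ### Differentiating translates under a continuous linear map -/

section Translates

variable [FiniteDimensional ℝ E] (T : 𝓢(E, F) →L[ℝ] V)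

/-- The derivative of `x ↦ T (f (· - x))`. -/
noncomputable def translateDeriv (f : 𝓢(E, F)) (x : E) : E →L[ℝ] V :=
  LinearMap.toContinuousLinearMap
    { toFun := fun v => T (compSubConstCLM ℝ x (-∂_{v} f))
      map_add' := fun v w => by rw [lineDerivOp_left_add, neg_add, map_add, map_add]
      map_smul' := fun c v => by
        rw [lineDerivOp_left_smul, ← smul_neg, map_smul, map_smul, RingHom.id_apply] }

theorem translateDeriv_apply (f : 𝓢(E, F)) (x v : E) :
    translateDeriv T f x v = T (compSubConstCLM ℝ x (-∂_{v} f)) := rfl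

theorem hasFDerivAt_translate (f : 𝓢(E, F)) (x : E) :
    HasFDerivAt (fun x => T (compSubConstCLM ℝ x f)) (translateDeriv T f x) x := by
  -- Translation by `x + h` is translation by `h` followed by translation by `x`; absorbing the
  -- latter into `T` reduces the claim to Taylor's estimate at the origin.
  obtain ⟨s, C, hC, hT⟩ := exists_norm_le_orderSeminorm (T ∘L compSubConstCLM ℝ x)
  rw [hasFDerivAt_iff_isLittleO_nhds_zero]
  have h1 : (fun h => T (compSubConstCLM ℝ (x + h) f) - T (compSubConstCLM ℝ x f) -
      translateDeriv T f x h) =O[𝓝 0] fun h => ‖h‖ ^ 2 := by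
    refine Asymptotics.IsBigO.of_bound (C * (2 ^ s * (2 ^ (s + 2) * orderSeminorm (s + 2) f))) ?_
    filter_upwards [Metric.closedBall_mem_nhds (0 : E) one_pos] with h hh
    have e : T (compSubConstCLM ℝ (x + h) f) - T (compSubConstCLM ℝ x f) -
        translateDeriv T f x h =
        (T ∘L compSubConstCLM ℝ x) (compSubConstCLM ℝ h f - f + ∂_{h} f) := by
      simp only [ContinuousLinearMap.comp_apply, map_add, map_sub, map_neg, translateDeriv_apply,
        sub_neg_eq_add, compSubConstCLM_comp, add_comm x h]
    rw [e, norm_pow, norm_norm, mul_assoc]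
    refine (hT _).trans (mul_le_mul_of_nonneg_left ?_ hC)
    exact orderSeminorm_taylor_le s f (by simpa using hh)
  exact h1.trans_isLittleO (Asymptotics.isLittleO_norm_pow_id one_lt_two)

/-- The derivative in direction `v` is the same kind of function, with `-∂_{v} f` in place of `f`.
-/
theorem contDiff_translate (f : 𝓢(E, F)) :
    ContDiff ℝ ∞ (fun x => T (compSubConstCLM ℝ x f)) := by
  refine contDiff_infty.2 fun m => ?_
  induction m generalizing f with
  | zero =>
    exact contDiff_zero.2 (continuous_iff_continuousAt.2 fun x =>
      (hasFDerivAt_translate T f x).continuousAt)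
  | succ m ih =>
    exact contDiff_succ_iff_hasFDerivAt.2 ⟨translateDeriv T f,
      contDiff_clm_apply_iff.2 fun v => ih (-∂_{v} f), hasFDerivAt_translate T f⟩

/-- Each derivative of the translate falls on `f` and raises the order of the seminorm by one. Since
`hT` holds for all `f`, it passes to the derivatives with the same constant. -/
theorem norm_iteratedFDeriv_translate_le {s : ℕ} {C : ℝ} {x : E}
    (hT : ∀ f, ‖T (compSubConstCLM ℝ x f)‖ ≤ C * orderSeminorm s f) (hC : 0 ≤ C) (k : ℕ)
    (f : 𝓢(E, F)) :
    ‖iteratedFDeriv ℝ k (fun x => T (compSubConstCLM ℝ x f)) x‖ ≤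
      C * orderSeminorm (s + k) f := by
  refine ContinuousMultilinearMap.opNorm_le_bound
    (mul_nonneg hC (apply_nonneg _ _)) fun m => ?_
  induction k generalizing f with
  | zero => simpa using hT f
  | succ k ih =>
    have h1 : (fun y => fderiv ℝ (fun x => T (compSubConstCLM ℝ x f)) y) = translateDeriv T f :=
      funext fun y => (hasFDerivAt_translate T f y).fderiv
    have h2 : ContDiff ℝ ∞ (translateDeriv T f) :=
      contDiff_clm_apply_iff.2 fun v => contDiff_translate T (-∂_{v} f)
    rw [iteratedFDeriv_succ_apply_right, h1, ← iteratedFDeriv_clm_apply_const_apply h2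
      (mod_cast le_top)]
    refine (ih (-∂_{m (Fin.last k)} f) (Fin.init m)).trans ?_
    rw [map_neg_eq_map, Fin.prod_univ_castSucc]
    calc C * orderSeminorm (s + k) (∂_{m (Fin.last k)} f) * ∏ i, ‖Fin.init m i‖
        ≤ C * (‖m (Fin.last k)‖ * orderSeminorm (s + k + 1) f) * ∏ i, ‖Fin.init m i‖ := by
          gcongr
          exact orderSeminorm_lineDerivOp_le _ _ _
      _ = C * orderSeminorm (s + (k + 1)) f *
          ((∏ i : Fin k, ‖m i.castSucc‖) * ‖m (Fin.last k)‖) := by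
        rw [← add_assoc]
        simp only [Fin.init]
        ring

end Translates

end SchwartzMap

/-! ## Generating functionals are moderate -/

namespace Colombeau

open scoped ContDiff
open SchwartzMap

variable {n : ℕ}

theorem RealTest.toSchwartz_apply (φ : RealTest n) (x : RSpace n) : φ.toSchwartz x = φ x := rfl

/-- The inclusion of test functions into Schwartz functions as a continuous linear map. -/
noncomputable def toSchwartzCLM (n : ℕ) : RealTest n →L[ℝ] 𝓢(RSpace n, ℝ) :=
  TestFunction.mkCLM ℝ RealTest.toSchwartz (fun _ _ => by ext x; rfl) (fun _ _ => by ext x; rfl)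
    fun K hK => by
      let L : ContDiffMapSupportedIn (RSpace n) ℝ ⊤ K →ₗ[ℝ] 𝓢(RSpace n, ℝ) :=
        { toFun := fun f => RealTest.toSchwartz (TestFunction.ofSupportedIn hK f)
          map_add' := fun _ _ => by ext x; rfl
          map_smul' := fun _ _ => by ext x; rfl }
      change Continuous L
      obtain ⟨r, hr⟩ := K.isCompact.isBounded.exists_norm_le
      -- On `K` the weight `‖x‖ ^ k` is at most `|r| ^ k`; off `K` all derivatives vanish.
      refine (ContDiffMapSupportedIn.withSeminorms ℝ (RSpace n) ℝ ⊤ K).continuous_of_isBounded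
        (schwartz_withSeminorms ℝ (RSpace n) ℝ) L fun ⟨k, l⟩ => ⟨{l}, (|r| ^ k).toNNReal, fun f => ?_⟩
      rw [Finset.sup_singleton]
      have hC : ((|r| ^ k).toNNReal : ℝ) = |r| ^ k := Real.coe_toNNReal _ (by positivity)
      change SchwartzMap.seminorm ℝ k l (L f) ≤ ((|r| ^ k).toNNReal : ℝ) * _
      rw [hC]
      have h0 := apply_nonneg (ContDiffMapSupportedIn.seminorm ℝ (RSpace n) ℝ ⊤ K l) f
      refine seminorm_le_bound ℝ k l _ (by positivity) fun x => ?_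
      have hL : ⇑(L f) = f := rfl
      rw [hL]
      by_cases hx : x ∈ K
      · gcongr
        · exact (hr x hx).trans (le_abs_self r)
        · exact ContDiffMapSupportedIn.norm_iteratedFDeriv_apply_le_seminorm_top ℝ
      · have : iteratedFDeriv ℝ l f x = 0 := by
          refine image_eq_zero_of_notMem_tsupport fun h => hx ?_
          exact f.tsupport_subset (tsupport_iteratedFDeriv_subset l h)
        rw [this, norm_zero, mul_zero]
        positivity

theorem contDiff_clm_comp_isSmoothCurve {E V : Type*} [AddCommGroup E] [Module ℝ E]
    [TopologicalSpace E] [NormedAddCommGroup V] [NormedSpace ℝ V] (T : E →L[ℝ] V) {c : ℝ → E}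
    (hc : IsSmoothCurve c) : ContDiff ℝ ∞ fun t => T (c t) := by
  obtain ⟨d, rfl, hd⟩ := hc
  have h : ∀ k t, HasDerivAt (fun t => T (d k t)) (T (d (k + 1) t)) t := fun k t => by
    rw [hasDerivAt_iff_tendsto_slope_zero]
    simpa [Function.comp_def] using (T.continuous.tendsto _).comp (hd k t)
  have key : ∀ m k : ℕ, ContDiff ℝ m fun t => T (d k t) := by
    intro m
    induction m with
    | zero =>
      exact fun k => contDiff_zero.2
        (continuous_iff_continuousAt.2 fun t => (h k t).continuousAt)
    | succ m ih =>
      intro k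
      rw [Nat.cast_succ, contDiff_succ_iff_deriv,
        show deriv (fun t => T (d k t)) = _ from funext fun t => (h k t).deriv]
      exact ⟨fun t => (h k t).differentiableAt, by simp, ih (k + 1)⟩
  exact contDiff_infty.2 fun m => key m 0

theorem deltaNet_apply (φ : RealTest n) {ε : ℝ} (hε : 0 < ε) (x y : RSpace n) :
    deltaNet φ ε x y = (ε ^ n)⁻¹ * φ (ε⁻¹ • (y - x)) := by
  rw [deltaNet, dif_pos hε]
  rfl

theorem toSchwartz_deltaNet (φ : RealTest n) {ε : ℝ} (hε : 0 < ε) (x : RSpace n) :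
    (deltaNet φ ε x).toSchwartz = compSubConstCLM ℝ x (deltaNet φ ε 0).toSchwartz := by
  ext y
  rw [compSubConstCLM_apply, RealTest.toSchwartz_apply, RealTest.toSchwartz_apply,
    deltaNet_apply φ hε, deltaNet_apply φ hε, sub_zero]

/-- The normalization costs `ε⁻ⁿ` and each of at most `s` derivatives costs `ε⁻¹`. The weights cost
nothing, because `‖y‖ ≤ ‖ε⁻¹ y‖`. -/
theorem orderSeminorm_deltaNet_le (φ : RealTest n) {ε : ℝ} (hε : 0 < ε) (hε1 : ε ≤ 1) (s : ℕ) :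
    orderSeminorm s (deltaNet φ ε 0).toSchwartz ≤
      ε⁻¹ ^ (n + s) * orderSeminorm s φ.toSchwartz := by
  have hi : 1 ≤ ε⁻¹ := (one_le_inv₀ hε).2 hε1
  have h0 : 0 ≤ ε⁻¹ ^ (n + s) * orderSeminorm s φ.toSchwartz :=
    mul_nonneg (by positivity) (apply_nonneg _ _)
  refine orderSeminorm_le h0 fun k hk l hl => seminorm_le_bound ℝ k l _ h0 fun y => ?_
  have e : ⇑(deltaNet φ ε 0).toSchwartz = (ε ^ n)⁻¹ • fun y => φ.toSchwartz (ε⁻¹ • y) := by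
    ext y
    rw [RealTest.toSchwartz_apply, deltaNet_apply φ hε, sub_zero]
    rfl
  have hs : ContDiff ℝ l φ.toSchwartz := φ.toSchwartz.smooth l
  rw [e, iteratedFDeriv_const_smul_apply (by fun_prop),
    congrFun (iteratedFDeriv_comp_const_smul ε⁻¹ hs) y, norm_smul, norm_smul, norm_pow, norm_inv, norm_inv, norm_pow, Real.norm_of_nonneg hε.le]
  have h1 : ‖y‖ ≤ ‖ε⁻¹ • y‖ := by
    rw [norm_smul, norm_inv, Real.norm_of_nonneg hε.le]
    exact le_mul_of_one_le_left (norm_nonneg y) hi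
  calc ‖y‖ ^ k * ((ε ^ n)⁻¹ * (ε⁻¹ ^ l * ‖iteratedFDeriv ℝ l φ.toSchwartz (ε⁻¹ • y)‖))
      = ε⁻¹ ^ (n + l) * (‖y‖ ^ k * ‖iteratedFDeriv ℝ l φ.toSchwartz (ε⁻¹ • y)‖) := by
        rw [pow_add, inv_pow]
        ring
    _ ≤ ε⁻¹ ^ (n + s) * (‖ε⁻¹ • y‖ ^ k * ‖iteratedFDeriv ℝ l φ.toSchwartz (ε⁻¹ • y)‖) := by
        gcongr
    _ ≤ ε⁻¹ ^ (n + s) * orderSeminorm s φ.toSchwartz := by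
        gcongr
        exact (le_seminorm ℝ k l _ _).trans (seminorm_le_orderSeminorm hk hl _)

/-! ### Functions that factor through a normed space -/

section Factorization

variable {R : RealTest n → ℂ} {V : Type*} [NormedAddCommGroup V] [NormedSpace ℝ V]
  {T : 𝓢(RSpace n, ℝ) →L[ℝ] V} {Φ : V → ℂ} {m : ℕ}

theorem contDiff_net_of_factorization (hΦ : ContDiff ℝ m Φ)
    (hR : ∀ φ, R φ = Φ (T φ.toSchwartz)) (φ : RealTest n) {ε : ℝ} (hε : 0 < ε) :
    ContDiff ℝ m fun x => R (deltaNet φ ε x) := by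
  have e : (fun x => R (deltaNet φ ε x)) =
      Φ ∘ fun x => T (compSubConstCLM ℝ x (deltaNet φ ε 0).toSchwartz) := by
    ext x
    rw [hR, toSchwartz_deltaNet φ hε]
    rfl
  rw [e]
  exact hΦ.comp (contDiff_infty.1 (contDiff_translate T _) m)

theorem contDiff_curve_of_factorization (hΦ : ContDiff ℝ m Φ)
    (hR : ∀ φ, R φ = Φ (T φ.toSchwartz)) {c : ℝ → RealTest n} (hc : IsSmoothCurve c) :
    ContDiff ℝ m fun t => R (c t) := by
  simp only [hR]
  exact hΦ.comp (contDiff_infty.1 (contDiff_clm_comp_isSmoothCurve (T ∘L toSchwartzCLM n) hc) m)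

/-- Faà di Bruno's formula in the form `norm_iteratedFDeriv_comp_le`: if the `i`-th derivatives of
the inner map are at most `Dⁱ`, the `m`-th derivative of the composite is at most `m! C Dᵐ`. Here
`D` is a constant times `ε^{-(n+s+m)}`. -/
theorem exists_derivBound_of_factorization (hΦ : ContDiff ℝ m Φ) {C : ℝ}
    (hC : ∀ k ≤ m, ∀ v, ‖iteratedFDeriv ℝ k Φ v‖ ≤ C)
    (hR : ∀ φ, R φ = Φ (T φ.toSchwartz)) {K : Set (RSpace n)} (hK : IsCompact K) :
    ∃ N : ℕ, ∀ φ, DerivBound R K φ m (-(N : ℤ)) := by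
  obtain ⟨s, B, hB, hT⟩ := exists_norm_le_orderSeminorm T
  obtain ⟨r, hr⟩ := hK.isBounded.exists_norm_le
  -- The cost of translating by any `x ∈ K` is included, which makes the estimate uniform on `K`.
  set B' : ℝ := B * ((1 + |r|) ^ s * 2 ^ s)
  have hB' : 0 ≤ B' := by positivity
  refine ⟨(n + (s + m)) * m, fun φ => ?_⟩
  -- The maximum with `1` ensures `D = A ε^{-(n+s+m)} ≥ 1`, hence `D ≤ Dⁱ` for `i ≥ 1`.
  set A : ℝ := max 1 (B' * orderSeminorm (s + m) φ.toSchwartz)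
  refine ⟨m.factorial * C * A ^ m, ?_⟩
  filter_upwards [Ioo_mem_nhdsGT (zero_lt_one : (0 : ℝ) < 1)] with ε ⟨hε, hε1⟩ x hx
  have hi : 1 ≤ ε⁻¹ := (one_le_inv₀ hε).2 hε1.le
  set ψ := (deltaNet φ ε 0).toSchwartz
  have hTx : ∀ f, ‖T (compSubConstCLM ℝ x f)‖ ≤ B' * orderSeminorm s f := fun f => by
    have hf := apply_nonneg (orderSeminorm s) f
    have hxr : ‖x‖ ≤ |r| := (hr x hx).trans (le_abs_self r)
    calc _ ≤ B * orderSeminorm s (compSubConstCLM ℝ x f) := hT _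
      _ ≤ B * ((1 + ‖x‖) ^ s * (2 ^ s * orderSeminorm s f)) := by
        gcongr
        exact orderSeminorm_compSubConstCLM_le s x f
      _ ≤ B * ((1 + |r|) ^ s * (2 ^ s * orderSeminorm s f)) := by gcongr
      _ = _ := by ring
  have hD : ∀ i, 1 ≤ i → i ≤ m →
      ‖iteratedFDeriv ℝ i (fun x => T (compSubConstCLM ℝ x ψ)) x‖ ≤
        (A * ε⁻¹ ^ (n + (s + m))) ^ i := by
    intro i hi1 him
    calc _ ≤ B' * orderSeminorm (s + i) ψ := norm_iteratedFDeriv_translate_le T hTx hB' i ψ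
      _ ≤ B' * (ε⁻¹ ^ (n + (s + m)) * orderSeminorm (s + m) φ.toSchwartz) := by
        gcongr
        exact (orderSeminorm_mono (by omega) ψ).trans
          (orderSeminorm_deltaNet_le φ hε hε1.le (s + m))
      _ = (B' * orderSeminorm (s + m) φ.toSchwartz) * ε⁻¹ ^ (n + (s + m)) := by ring
      _ ≤ A * ε⁻¹ ^ (n + (s + m)) := by
        gcongr
        exact le_max_right _ _
      _ ≤ _ := le_self_pow₀ (one_le_mul_of_one_le_of_one_le (le_max_left _ _) (one_le_pow₀ hi))
        (by omega)
  have e : (fun y => R (deltaNet φ ε y)) = Φ ∘ fun x => T (compSubConstCLM ℝ x ψ) := by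
    ext y
    rw [hR, toSchwartz_deltaNet φ hε]
    rfl
  rw [e]
  refine (norm_iteratedFDeriv_comp_le hΦ (contDiff_infty.1 (contDiff_translate T ψ) m) le_rfl x
    (fun i hi => hC i hi _) hD).trans_eq ?_
  rw [mul_pow, ← pow_mul, zpow_neg, zpow_natCast, inv_pow]
  ring

end Factorization

/-- The normed space may change with `m`: smoothness and moderateness are tested one order at a
time, and a fixed `Lᵖ` would provide only finitely many derivatives of `Φ`. -/
theorem isModerate_of_factorization {R : RealTest n → ℂ}
    (h : ∀ m : ℕ, ∃ (V : Type) (_ : NormedAddCommGroup V) (_ : NormedSpace ℝ V)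
      (T : 𝓢(RSpace n, ℝ) →L[ℝ] V) (Φ : V → ℂ), ContDiff ℝ m Φ ∧
        (∃ C, ∀ k ≤ m, ∀ v, ‖iteratedFDeriv ℝ k Φ v‖ ≤ C) ∧ ∀ φ, R φ = Φ (T φ.toSchwartz)) :
    IsModerate R := by
  refine ⟨⟨fun c hc => contDiff_infty.2 fun m => ?_,
    fun φ ε hε => contDiff_infty.2 fun m => ?_⟩, fun K hK m => ?_⟩
  · obtain ⟨V, _, _, T, Φ, hΦ, -, hR⟩ := h m
    exact contDiff_curve_of_factorization hΦ hR hc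
  · obtain ⟨V, _, _, T, Φ, hΦ, -, hR⟩ := h m
    exact contDiff_net_of_factorization hΦ hR φ hε
  · obtain ⟨V, _, _, T, Φ, hΦ, ⟨C, hC⟩, hR⟩ := h m
    obtain ⟨N, hN⟩ := exists_derivBound_of_factorization hΦ hC hR hK
    exact ⟨N, fun φ _ => hN φ⟩

theorem isModerate_generatingFunctional {ν : Measure (RealTempered n)} [IsProbabilityMeasure ν]
    {F : 𝓢(RSpace n, ℝ) → ℂ} (hF : IsGeneratingFunctional ν F) (hν : HasPolynomialGrowth ν) :
    IsModerate fun φ : RealTest n => F φ.toSchwartz := by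
  refine isModerate_of_factorization fun m => ?_
  have : Fact (1 ≤ ((m + 1 : ℕ) : ℝ≥0∞)) := ⟨by exact_mod_cast Nat.succ_pos m⟩
  obtain ⟨h1, h2⟩ := contDiff_integral_exp (ν := ν) m
  refine ⟨_, _, _, ⟨evalLM hν (m + 1), evalLM_continuous hν (m + 1)⟩, _, h1, h2, fun φ => ?_⟩
  rw [hF]
  refine integral_congr_ae ?_
  filter_upwards [(hν.memLp (m + 1) φ.toSchwartz).coeFn_toLp] with u hu
  rw [← hu]
  rfl

end Colombeau

theorem mainTheorem7 (n : ℕ) {A : Type*} [CStarAlgebra A] (W : L2Space n → A)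
    (hW : IsWeylAlgebra (symplecticForm n) W) (ω : A →ₗ[ℂ] ℂ) (hω : IsState ω)
    (g : L2Space n → ℂ) (hg : ∀ z, g z = ω (W z)) (hcont : Continuous g) :
    (∀ ν₁ : Measure (RealTempered n), IsProbabilityMeasure ν₁ → ν₁.Regular →
      IsGeneratingFunctional ν₁ (fun φ => g (schwartzToL2 φ)) → HasPolynomialGrowth ν₁ →
      ∃ G : Colombeau.GeneralizedFunction n,
        Colombeau.IsClassOf G (fun φ => g (schwartzToL2 φ.toSchwartz))) ∧
    (∀ ν₂ : Measure (RealTempered n), IsProbabilityMeasure ν₂ → ν₂.Regular →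
      IsGeneratingFunctional ν₂ (fun φ => g (Complex.I • schwartzToL2 φ)) →
      HasPolynomialGrowth ν₂ →
      ∃ G : Colombeau.GeneralizedFunction n,
        Colombeau.IsClassOf G (fun φ => g (Complex.I • schwartzToL2 φ.toSchwartz))) := by
  -- Each part concerns the generating functional of its own measure; the factor `i` only changes
  -- which functional that is.
  exact ⟨fun _ _ _ hF hν => ⟨_, Colombeau.isModerate_generatingFunctional hF hν, rfl⟩,
    fun _ _ _ hF hν => ⟨_, Colombeau.isModerate_generatingFunctional hF hν, rfl⟩⟩
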